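/- Let $\mathbb{D}=\{z\in\mathbb{C}:|z|<1\}$ and let $\psi$ be a Ma–Minda function, that is, $\psi$ is analytic and univalent in $\mathbb{D}$ with $\operatorname{Re}\psi(z)>0$ for $z\in\mathbb{D}$, $\psi(0)=1$, $\psi'(0)>0$, and $\psi(\mathbb{D})$ symmetric about the real axis. Let $\mathcal{S}^*(\psi)$ be the class of analytic functions $f$ in $\mathbb{D}$ with $f(0)=0$, $f'(0)=1$ and $zf'(z)/f(z)\prec\psi(z)$, where $\prec$ denotes subordination: $g\prec h$ if $g=h\circ w$ on $\mathbb{D}$ for some analytic $w:\mathbb{D}\to\mathbb{D}$ with $w(0)=0$. Put $$f_0(z)=z\exp\int_0^z\frac{\psi(t)-1}{t}\,dt\qquad(z\in\mathbb{D}).$$ Let $0<r<1$, and let $z_1,z_2$ be points of the circle $|z|=r$ such that $\min_{|z|=r}|\psi(z)|=|\psi(z_1)|$ and $\max_{|z|=r}|\psi(z)|=|\psi(z_2)|$. Then $f_0(r)$ and $f_0(-r)$ are real, and for every $f\in\mathcal{S}^*(\psi)$ and every $z_0$ with $|z_0|=r$, $$|\psi(z_1)|\left(\frac{-f_0(-r)}{r}\right)\le|f'(z_0)|\le\left(\frac{f_0(r)}{r}\right)|\psi(z_2)|.$$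 -/

import Mathlib

open Complex Metric Set

noncomputable section

/-- Ma–Minda functions: analytic and univalent on the open unit disk `𝔻`, with
`Re ψ > 0`, `ψ(0) = 1`, `ψ'(0) > 0` (a positive real number), and `ψ(𝔻)` symmetric
about the real axis. -/
structure IsMaMinda (ψ : ℂ → ℂ) : Prop where
  analytic : DifferentiableOn ℂ ψ (ball 0 1)
  univalent : InjOn ψ (ball 0 1)
  re_pos : ∀ z ∈ ball (0 : ℂ) 1, 0 < (ψ z).re
  map_zero : ψ 0 = 1
  deriv_zero_re : 0 < (deriv ψ 0).re
  deriv_zero_im : (deriv ψ 0).im = 0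
  symm : ∀ u ∈ ψ '' ball 0 1, (starRingEnd ℂ) u ∈ ψ '' ball 0 1

/-- The class `𝒜` of analytic functions `f(z) = z + a₂ z² + ⋯` on the open unit disk. -/
structure IsNormalizedAnalytic (f : ℂ → ℂ) : Prop where
  analytic : DifferentiableOn ℂ f (ball 0 1)
  map_zero : f 0 = 0
  deriv_zero : deriv f 0 = 1

/-- Subordination `g ≺ h` on the open unit disk: `g = h ∘ w` there, for an analytic self-map
`w` of the disk that fixes the origin. -/
def Subordinate (g h : ℂ → ℂ) : Prop :=
  ∃ w : ℂ → ℂ, DifferentiableOn ℂ w (ball 0 1) ∧ MapsTo w (ball 0 1) (ball 0 1) ∧ w 0 = 0 ∧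
    ∀ z ∈ ball (0 : ℂ) 1, g z = h (w z)

/-- The function `z f'(z) / f(z)`, with its removable singularity at the origin filled in
by the value `1` (which is the limit there for `f ∈ 𝒜`). -/
def starlikeQuotient (f : ℂ → ℂ) (z : ℂ) : ℂ :=
  if z = 0 then 1 else z * deriv f z / f z

/-- The class `𝒮*(ψ)`: functions `f ∈ 𝒜` with `z f'(z) / f(z) ≺ ψ(z)`. The nonvanishing of `f`
off the origin is what makes the quotient meaningful on the disk. -/
structure MaMindaStarlike (ψ f : ℂ → ℂ) : Prop where
  normalized : IsNormalizedAnalytic f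
  ne_zero : ∀ z ∈ ball (0 : ℂ) 1, z ≠ 0 → f z ≠ 0
  subordinate : Subordinate (starlikeQuotient f) ψ

/-- The function `f₀(z) = z exp ∫₀^z (ψ(t) - 1)/t dt`; the path of integration is the segment
`t = s z`, `0 ≤ s ≤ 1`. -/
def extremalStarlike (ψ : ℂ → ℂ) (z : ℂ) : ℂ :=
  z * Complex.exp (∫ s in (0 : ℝ)..1, (ψ (s * z) - 1) / (s * z) * z)

end

open scoped ComplexConjugate Topology

/-! Writing zf'/f = ψ∘w gives f' = (f/z)·ψ(w). By Schwarz |w(z₀)| ≤ r, so the maximum modulus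
principle for ψ and 1/ψ bounds |ψ(w(z₀))| by its extremes on the circle. It remains to bound |f/z|
by exp P(±r), where P is `maMindaPrimitive` and f₀(x) = x·exp P(x) for real x.

Put p = log(f/z), so that zp' = ψ(w) - 1. Since ψ(𝔻) need not be convex, Re ψ(w) ≤ ψ(|z|) may fail
pointwise. But where Re p is extremal on a circle, its tangential derivative vanishes and zp' is
real; then ψ(w) is real, and symmetry with univalence makes w real. As ψ increases on (-1, 1),
ψ(-|z|) ≤ ψ(w) ≤ ψ(|z|) holds at exactly these points, and a maximum principle
(`re_le_of_im_mul_deriv_eq_zero`) needs no more. -/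

/-- A univalent function on the unit disk has a holomorphic inverse on its image. -/
theorem differentiableAt_invFunOn_ball {ψ : ℂ → ℂ} (hd : DifferentiableOn ℂ ψ (ball 0 1))
    (hi : InjOn ψ (ball 0 1)) {u : ℂ} (hu : u ∈ ψ '' ball 0 1) :
    DifferentiableAt ℂ (Function.invFunOn ψ (ball 0 1)) u := by
  set g := Function.invFunOn ψ (ball (0 : ℂ) 1) with hg
  have hgl : ∀ z ∈ ball (0 : ℂ) 1, g (ψ z) = z := fun z hz => hi.leftInvOn_invFunOn hz
  have hgm : ∀ u ∈ ψ '' ball 0 1, g u ∈ ball (0 : ℂ) 1 := fun u hu => Function.invFunOn_mem hu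
  have hgr : ∀ u ∈ ψ '' ball 0 1, ψ (g u) = u := fun u hu => Function.invFunOn_eq hu
  have han : AnalyticOnNhd ℂ ψ (ball 0 1) := hd.analyticOnNhd isOpen_ball
  have hopen : ∀ s ⊆ ball (0 : ℂ) 1, IsOpen s → IsOpen (ψ '' s) := by
    refine (han.is_constant_or_isOpen (convex_ball (0 : ℂ) 1).isPreconnected).resolve_left ?_
    rintro ⟨c, hc⟩
    have h0 : (0 : ℂ) ∈ ball (0 : ℂ) 1 := by simp
    have h1 : (1 / 2 : ℂ) ∈ ball (0 : ℂ) 1 := by norm_num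
    have := hi h0 h1 ((hc _ h0).trans (hc _ h1).symm)
    norm_num at this
  have hcont : ∀ u ∈ ψ '' ball 0 1, ContinuousAt g u := by
    intro u hu
    rw [ContinuousAt, Filter.tendsto_def]
    intro s hs
    obtain ⟨t, hts, hto, hut⟩ := _root_.mem_nhds_iff.1 hs
    refine Filter.mem_of_superset ((hopen (t ∩ ball 0 1) inter_subset_right
      (hto.inter isOpen_ball)).mem_nhds ⟨g u, ⟨hut, hgm u hu⟩, hgr u hu⟩) ?_
    rintro _ ⟨z, ⟨hzt, hzb⟩, rfl⟩
    rw [mem_preimage, hgl z hzb]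
    exact hts hzt
  have himo : IsOpen (ψ '' ball 0 1) := hopen _ subset_rfl isOpen_ball
  have hdiff : ∀ v ∈ ψ '' ball 0 1, deriv ψ (g v) ≠ 0 → DifferentiableAt ℂ g v := by
    intro v hv hne
    have h1 : HasDerivAt ψ (deriv ψ (g v)) (g v) :=
      (hd.differentiableAt (isOpen_ball.mem_nhds (hgm v hv))).hasDerivAt
    refine (h1.of_local_left_inverse (hcont v hv) hne ?_).differentiableAt
    filter_upwards [himo.mem_nhds hv] with y hy using hgr y hy
  -- Zeros of ψ' are isolated, so the continuous inverse is holomorphic off isolated points, and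
  -- these are removable.
  refine (analyticAt_of_differentiable_on_punctured_nhds_of_continuousAt ?_
    (hcont u hu)).differentiableAt
  have hdan : AnalyticAt ℂ (deriv ψ) (g u) := (han (g u) (hgm u hu)).deriv
  have hne : ∀ᶠ z in 𝓝[≠] (g u), deriv ψ z ≠ 0 := by
    refine hdan.eventually_eq_zero_or_eventually_ne_zero.resolve_left fun h => ?_
    have hz : EqOn (deriv ψ) 0 (ball 0 1) :=
      (han.deriv).eqOn_zero_of_preconnected_of_eventuallyEq_zero
        (convex_ball (0 : ℂ) 1).isPreconnected (hgm u hu) h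
    have h0 : (0 : ℂ) ∈ ball (0 : ℂ) 1 := by simp
    have h1 : (1 / 2 : ℂ) ∈ ball (0 : ℂ) 1 := by norm_num
    have := hi h0 h1 (isOpen_ball.is_const_of_deriv_eq_zero
      (convex_ball (0 : ℂ) 1).isPreconnected hd hz h0 h1)
    norm_num at this
  have ht : Filter.Tendsto g (𝓝[≠] u) (𝓝[≠] (g u)) := by
    refine tendsto_nhdsWithin_iff.2 ⟨(hcont u hu).tendsto.mono_left nhdsWithin_le_nhds, ?_⟩
    filter_upwards [nhdsWithin_le_nhds (himo.mem_nhds hu), self_mem_nhdsWithin] with v hv hvu heq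
    exact hvu (by rw [mem_singleton_iff, ← hgr v hv, heq, hgr u hu])
  filter_upwards [nhdsWithin_le_nhds (himo.mem_nhds hu), ht.eventually hne] with v hv h
  exact hdiff v hv h

/-! ### Ma–Minda functions and the real axis -/

namespace IsMaMinda

variable {ψ : ℂ → ℂ}

theorem deriv_zero_ne_zero (hψ : IsMaMinda ψ) : deriv ψ 0 ≠ 0 := fun h => by
  simpa [h] using hψ.deriv_zero_re

theorem differentiableAt (hψ : IsMaMinda ψ) {z : ℂ} (hz : z ∈ ball (0 : ℂ) 1) :
    DifferentiableAt ℂ ψ z :=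
  hψ.analytic.differentiableAt (isOpen_ball.mem_nhds hz)

/-- A Ma–Minda function commutes with complex conjugation. -/
theorem map_conj (hψ : IsMaMinda ψ) {z : ℂ} (hz : z ∈ ball (0 : ℂ) 1) :
    ψ (conj z) = conj (ψ z) := by
  set g := Function.invFunOn ψ (ball (0 : ℂ) 1) with hg
  have hconj : ∀ {z : ℂ}, z ∈ ball (0 : ℂ) 1 → conj z ∈ ball (0 : ℂ) 1 := by simp
  have h0 : (0 : ℂ) ∈ ball (0 : ℂ) 1 := by simp
  set k : ℂ → ℂ := conj ∘ ψ ∘ conj with hk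
  have hkm : ∀ z ∈ ball (0 : ℂ) 1, k z ∈ ψ '' ball 0 1 := fun z hz =>
    hψ.symm _ ⟨_, hconj hz, rfl⟩
  have hkd : ∀ z ∈ ball (0 : ℂ) 1, DifferentiableAt ℂ k z := fun z hz => by
    have := (hψ.differentiableAt (hconj hz)).conj_conj
    rwa [conj_conj] at this
  have hφm : MapsTo (g ∘ k) (ball 0 1) (ball 0 1) := fun z hz => Function.invFunOn_mem (hkm z hz)
  have hφd : ∀ z ∈ ball (0 : ℂ) 1, DifferentiableAt ℂ (g ∘ k) z := fun z hz =>
    (differentiableAt_invFunOn_ball hψ.analytic hψ.univalent (hkm z hz)).comp z (hkd z hz)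
  have hφψ : ∀ z ∈ ball (0 : ℂ) 1, ψ ((g ∘ k) z) = k z := fun z hz =>
    Function.invFunOn_eq (hkm z hz)
  have hφ0 : (g ∘ k) 0 = 0 := by
    refine hψ.univalent (hφm h0) h0 ?_
    rw [hφψ 0 h0]
    simp [hk, hψ.map_zero]
  have hder : deriv (g ∘ k) 0 = 1 := by
    have h1 : HasDerivAt (ψ ∘ (g ∘ k)) (deriv ψ 0 * deriv (g ∘ k) 0) 0 := by
      refine HasDerivAt.comp 0 ?_ (hφd 0 h0).hasDerivAt
      rw [hφ0]
      exact (hψ.differentiableAt h0).hasDerivAt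
    have h2 : HasDerivAt k (conj (deriv ψ 0)) 0 := by
      have := (hψ.differentiableAt h0).hasDerivAt.conj_conj
      rwa [_root_.map_zero (starRingEnd ℂ)] at this
    have h3 : HasDerivAt k (deriv ψ 0 * deriv (g ∘ k) 0) 0 := by
      refine h1.congr_of_eventuallyEq ?_
      filter_upwards [isOpen_ball.mem_nhds h0] with z hz using (hφψ z hz).symm
    have h4 := h3.unique h2
    rw [conj_eq_iff_im.2 hψ.deriv_zero_im] at h4
    exact mul_left_cancel₀ hψ.deriv_zero_ne_zero (h4.trans (mul_one _).symm)
  -- Equality case of the Schwarz lemma: ψ⁻¹ ∘ conj ∘ ψ ∘ conj is a self-map of the disk fixing 0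
  -- with derivative 1, hence the identity.
  have hid := affine_of_mapsTo_ball_of_norm_dslope_eq_div (f := g ∘ k) (c := 0) (z₀ := 0)
    (R₁ := 1) (R₂ := 1) (fun z hz => (hφd z hz).differentiableWithinAt)
    (by rw [hφ0]; exact hφm.mono_right ball_subset_closedBall) h0 (by simp [hder])
  have h5 : (g ∘ k) z = z := by
    rw [hid hz, hφ0]
    simp [hder]
  have h6 := hφψ z hz
  rw [h5] at h6
  rw [h6]
  simp [hk]

theorem im_ofReal (hψ : IsMaMinda ψ) {x : ℝ} (hx : x ∈ Ioo (-1) 1) : (ψ x).im = 0 := by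
  have hz : (x : ℂ) ∈ ball (0 : ℂ) 1 := by simpa [abs_lt] using hx
  have := hψ.map_conj hz
  rw [conj_ofReal] at this
  exact conj_eq_iff_im.1 this.symm

theorem im_eq_zero_of_im_map_eq_zero (hψ : IsMaMinda ψ) {z : ℂ} (hz : z ∈ ball (0 : ℂ) 1)
    (h : (ψ z).im = 0) : z.im = 0 := by
  refine conj_eq_iff_im.1 (hψ.univalent (by simpa using hz) hz ?_)
  rw [hψ.map_conj hz, conj_eq_iff_im.2 h]

/-- A continuous injective real function on an interval is strictly monotone; ψ'(0) > 0 settles the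
direction. -/
theorem strictMonoOn_re (hψ : IsMaMinda ψ) :
    StrictMonoOn (fun x : ℝ => (ψ x).re) (Ioo (-1) 1) := by
  have hmem : ∀ x ∈ Ioo (-1 : ℝ) 1, (x : ℂ) ∈ ball (0 : ℂ) 1 := fun x hx => by
    simpa [abs_lt] using hx
  have hc : ContinuousOn (fun x : ℝ => (ψ x).re) (Ioo (-1) 1) :=
    continuous_re.comp_continuousOn (hψ.analytic.continuousOn.comp
      continuous_ofReal.continuousOn hmem)
  have hi : InjOn (fun x : ℝ => (ψ x).re) (Ioo (-1) 1) := fun x hx y hy hxy =>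
    ofReal_injective (hψ.univalent (hmem x hx) (hmem y hy)
      (Complex.ext hxy (by rw [hψ.im_ofReal hx, hψ.im_ofReal hy])))
  refine (hc.strictMonoOn_of_injOn_Ioo (by norm_num) hi).resolve_right fun hanti => ?_
  have hder : HasDerivAt (fun x : ℝ => (ψ x).re) (deriv ψ 0).re 0 := by
    have : HasDerivAt ψ (deriv ψ 0) ((0 : ℝ) : ℂ) := by
      simpa using (hψ.differentiableAt (by simp)).hasDerivAt
    exact this.real_of_complex
  have hpos := hψ.deriv_zero_re
  have hnonpos : derivWithin (fun x : ℝ => (ψ x).re) (Ioo (-1) 1) 0 ≤ 0 :=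
    hanti.antitoneOn.derivWithin_nonpos
  rw [derivWithin_of_isOpen isOpen_Ioo (by norm_num), hder.deriv] at hnonpos
  exact hpos.not_ge hnonpos

end IsMaMinda

/-! ### Maximum principle and logarithm -/

/-- If `z p'(z)` is bounded by `g ‖z‖` wherever it is real, then `re p` is bounded on every disk
by the radial primitive of `g t / t`. -/
theorem re_le_of_im_mul_deriv_eq_zero {p : ℂ → ℂ} {g H : ℝ → ℝ}
    (hp : DifferentiableOn ℂ p (ball 0 1)) (hp0 : p 0 = 0) (hH0 : H 0 = 0)
    (hHc : ContinuousOn H (Ioo (-1) 1))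
    (hH : ∀ t ∈ Ioo (0 : ℝ) 1, HasDerivAt H (g t / t) t)
    (hle : ∀ z ∈ ball (0 : ℂ) 1, z ≠ 0 → (z * deriv p z).im = 0 →
      (z * deriv p z).re ≤ g ‖z‖)
    {z₀ : ℂ} (hz₀ : z₀ ∈ ball (0 : ℂ) 1) : (p z₀).re ≤ H ‖z₀‖ := by
  refine le_of_forall_pos_le_add fun ε hε => ?_
  set r := ‖z₀‖ with hr
  have hr1 : r < 1 := by simpa using hz₀
  have hsub : closedBall (0 : ℂ) r ⊆ ball 0 1 := closedBall_subset_ball hr1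
  -- The term ε‖z‖ makes the radial derivative strictly negative at a nonzero maximum, so the
  -- maximum must sit at 0, where u vanishes.
  set u : ℂ → ℝ := fun z => (p z).re - H ‖z‖ - ε * ‖z‖ with hu
  have huc : ContinuousOn u (closedBall 0 r) := by
    refine ((continuous_re.comp_continuousOn (hp.continuousOn.mono hsub)).sub
      (hHc.comp continuous_norm.continuousOn fun z hz => ?_)).sub (by fun_prop)
    have h1 : ‖z‖ < 1 := by simpa using hsub hz
    exact ⟨by linarith [norm_nonneg z], h1⟩
  obtain ⟨z, hz, hmax⟩ := (isCompact_closedBall (0 : ℂ) r).exists_isMaxOn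
    ⟨0, by simp [hr]⟩ huc
  have hzr : ‖z‖ ≤ r := by simpa using hz
  suffices h0 : z = 0 by
    have h1 : u z₀ ≤ u z := hmax (by simp [hr])
    rw [h0] at h1
    simp only [hu, hp0, norm_zero, hH0, zero_re, mul_zero, sub_zero] at h1
    have : ε * ‖z₀‖ ≤ ε := mul_le_of_le_one_right hε.le hr1.le
    linarith
  by_contra hz0
  have htpos : 0 < ‖z‖ := norm_pos_iff.2 hz0
  have hzb : z ∈ ball (0 : ℂ) 1 := hsub hz
  have hpd : HasDerivAt p (deriv p z) z :=
    (hp.differentiableAt (isOpen_ball.mem_nhds hzb)).hasDerivAt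
  have hcurve : ∀ {γ : ℝ → ℂ} {γ' : ℂ} {s : ℝ}, HasDerivAt γ γ' s → γ s = z →
      HasDerivAt (fun x => (p (γ x)).re) (deriv p z * γ').re s := by
    intro γ γ' s hγ hs
    rw [← hs] at hpd
    have h := hpd.comp s hγ
    rw [hs] at h
    exact reCLM.hasFDerivAt.comp_hasDerivAt s h
  have him : (z * deriv p z).im = 0 := by
    have hγ : HasDerivAt (fun x : ℝ => z * cexp (x * I)) (z * I) 0 := by
      have h1 : HasDerivAt (fun x : ℝ => (x : ℂ) * I) I 0 := by
        simpa using (hasDerivAt_id (0 : ℝ)).ofReal_comp.mul_const I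
      simpa using h1.cexp.const_mul z
    have h1 := hcurve hγ (by simp)
    have h2 : IsLocalMax (fun x : ℝ => (p (z * cexp (x * I))).re) 0 := by
      refine Filter.Eventually.of_forall fun x => ?_
      have hn : ‖z * cexp (x * I)‖ = ‖z‖ := by rw [norm_mul, norm_exp_ofReal_mul_I, mul_one]
      have h3 : u (z * cexp (x * I)) ≤ u z := hmax (by simpa [hn] using hzr)
      simp only [hu, hn] at h3
      simp only [ofReal_zero, zero_mul, Complex.exp_zero, mul_one]
      linarith
    have h3 := h2.hasDerivAt_eq_zero h1
    rw [show deriv p z * (z * I) = (z * deriv p z) * I by ring, mul_I_re] at h3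
    linarith
  have hre : (z * deriv p z).re ≤ g ‖z‖ := hle z hzb hz0 him
  have hrad : HasDerivAt (fun x : ℝ => (p (x * (z / ‖z‖))).re - H x - ε * x)
      ((z * deriv p z).re / ‖z‖ - g ‖z‖ / ‖z‖ - ε) ‖z‖ := by
    have hγ : HasDerivAt (fun x : ℝ => (x : ℂ) * (z / ‖z‖)) (z / ‖z‖) ‖z‖ := by
      simpa using (hasDerivAt_id ‖z‖).ofReal_comp.mul_const (z / (‖z‖ : ℂ))
    have h1 := hcurve hγ (mul_div_cancel₀ z (by exact_mod_cast htpos.ne'))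
    have h2 : (deriv p z * (z / ‖z‖)).re = (z * deriv p z).re / ‖z‖ := by
      rw [← div_ofReal_re]
      congr 1
      ring
    rw [h2] at h1
    have h3 := (hasDerivAt_id' ‖z‖).const_mul ε
    rw [mul_one] at h3
    exact (h1.sub (hH ‖z‖ ⟨htpos, by simpa using hzb⟩)).sub h3
  have hneg : (z * deriv p z).re / ‖z‖ - g ‖z‖ / ‖z‖ - ε < 0 := by
    have := div_le_div_of_nonneg_right hre htpos.le
    linarith
  -- Only the inward (left) slope is usable, since z may lie on the boundary circle.
  have hslope := hasDerivAt_iff_tendsto_slope_left_right.1 hrad |>.1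
  have hev : ∀ᶠ x in 𝓝[<] ‖z‖, slope (fun x : ℝ => (p (x * (z / ‖z‖))).re - H x - ε * x)
      ‖z‖ x < 0 := hslope.eventually (gt_mem_nhds hneg)
  obtain ⟨x, hx, hx0, hxz⟩ := (hev.and (Ioo_mem_nhdsLT htpos)).exists
  rw [slope_def_field, div_neg_iff] at hx
  have hn : ‖(x : ℂ) * (z / ‖z‖)‖ = x := by
    rw [norm_mul, norm_div, norm_real, norm_real, norm_norm, div_self htpos.ne', mul_one,
      Real.norm_of_nonneg hx0.le]
  have h3 : u (x * (z / ‖z‖)) ≤ u z := hmax (mem_closedBall_zero_iff.2 (hn.trans_le (hxz.le.trans hzr)))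
  have h4 : ((‖z‖ : ℝ) : ℂ) * (z / ‖z‖) = z := mul_div_cancel₀ z (by exact_mod_cast htpos.ne')
  simp only [hu, hn] at h3
  rw [h4] at hx
  rcases hx with ⟨h5, -⟩ | ⟨-, h6⟩ <;> linarith

/-- A nonvanishing holomorphic function on the unit disk with value `1` at `0` has a logarithm. -/
theorem exists_log_of_ne_zero_ball {q : ℂ → ℂ} (hq : DifferentiableOn ℂ q (ball 0 1))
    (hne : ∀ z ∈ ball (0 : ℂ) 1, q z ≠ 0) (hq0 : q 0 = 1) :
    ∃ p : ℂ → ℂ, p 0 = 0 ∧ (∀ z ∈ ball (0 : ℂ) 1, HasDerivAt p (deriv q z / q z) z) ∧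
      ∀ z ∈ ball (0 : ℂ) 1, q z = cexp (p z) := by
  have hd : DifferentiableOn ℂ (fun z => deriv q z / q z) (ball 0 1) :=
    (hq.deriv isOpen_ball).div hq hne
  obtain ⟨p, hp0, hp⟩ := hd.isExactOn_ball.with_val_at 0 0
  refine ⟨p, hp0, hp, fun z hz => ?_⟩
  have h0 : (0 : ℂ) ∈ ball (0 : ℂ) 1 := by simp
  have hF : ∀ z ∈ ball (0 : ℂ) 1, HasDerivAt (fun z => q z * cexp (-p z)) 0 z := fun z hz => by
    have h1 := (hq.differentiableAt (isOpen_ball.mem_nhds hz)).hasDerivAt.mul (hp z hz).neg.cexp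
    convert! h1 using 1
    have := hne z hz
    field_simp
    ring
  have hc := isOpen_ball.is_const_of_deriv_eq_zero (convex_ball (0 : ℂ) 1).isPreconnected
    (fun z hz => (hF z hz).differentiableAt.differentiableWithinAt)
    (fun z hz => (hF z hz).deriv) hz h0
  simp only [hp0, hq0, neg_zero, Complex.exp_zero, mul_one] at hc
  rw [Complex.exp_neg, ← div_eq_mul_inv, div_eq_one_iff_eq (Complex.exp_ne_zero _)] at hc
  exact hc

/-! ### The extremal function on the real axis -/

/-- The real primitive `x ↦ ∫₀ˣ (ψ(t) - 1)/t dt` of a Ma–Minda function. -/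
noncomputable def maMindaPrimitive (ψ : ℂ → ℂ) (x : ℝ) : ℝ :=
  ∫ t in (0 : ℝ)..x, (dslope ψ 0 (t : ℂ)).re

namespace IsMaMinda

variable {ψ : ℂ → ℂ}

theorem continuousOn_dslope_re (hψ : IsMaMinda ψ) :
    ContinuousOn (fun t : ℝ => (dslope ψ 0 (t : ℂ)).re) (Ioo (-1) 1) := by
  have hd : DifferentiableOn ℂ (dslope ψ 0) (ball 0 1) :=
    (differentiableOn_dslope (ball_mem_nhds 0 one_pos)).2 hψ.analytic
  exact continuous_re.comp_continuousOn (hd.continuousOn.comp continuous_ofReal.continuousOn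
    fun x hx => by simpa [abs_lt] using hx)

theorem dslope_ofReal (hψ : IsMaMinda ψ) {x : ℝ} (hx : x ∈ Ioo (-1) 1) (hx0 : x ≠ 0) :
    (ψ x - 1) / x = ((dslope ψ 0 (x : ℂ)).re : ℂ) := by
  have h : dslope ψ 0 (x : ℂ) = (((ψ x).re - 1) / x : ℝ) := by
    rw [dslope_of_ne _ (ofReal_ne_zero.2 hx0), slope_def_field, hψ.map_zero, sub_zero]
    conv_lhs => rw [← re_add_im (ψ x), hψ.im_ofReal hx]
    simp
  rw [h, ofReal_re, ← h, dslope_of_ne _ (ofReal_ne_zero.2 hx0), slope_def_field, hψ.map_zero,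
    sub_zero]

theorem hasDerivAt_maMindaPrimitive (hψ : IsMaMinda ψ) {x : ℝ} (hx : x ∈ Ioo (-1) 1) :
    HasDerivAt (maMindaPrimitive ψ) (dslope ψ 0 (x : ℂ)).re x := by
  have hsub : uIcc 0 x ⊆ Ioo (-1 : ℝ) 1 := ordConnected_Ioo.uIcc_subset (by norm_num) hx
  exact intervalIntegral.integral_hasDerivAt_right
    (hψ.continuousOn_dslope_re.mono hsub).intervalIntegrable
    (hψ.continuousOn_dslope_re.stronglyMeasurableAtFilter isOpen_Ioo x hx)
    (hψ.continuousOn_dslope_re.continuousAt (isOpen_Ioo.mem_nhds hx))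

theorem hasDerivAt_maMindaPrimitive_of_ne_zero (hψ : IsMaMinda ψ) {x : ℝ}
    (hx : x ∈ Ioo (-1) 1) (hx0 : x ≠ 0) :
    HasDerivAt (maMindaPrimitive ψ) (((ψ x).re - 1) / x) x := by
  have h := congrArg re (hψ.dslope_ofReal hx hx0)
  rw [ofReal_re, div_ofReal_re, sub_re, one_re] at h
  rw [h]
  exact hψ.hasDerivAt_maMindaPrimitive hx

theorem continuousOn_maMindaPrimitive (hψ : IsMaMinda ψ) :
    ContinuousOn (maMindaPrimitive ψ) (Ioo (-1) 1) := fun _ hx =>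
  (hψ.hasDerivAt_maMindaPrimitive hx).continuousAt.continuousWithinAt

theorem extremalStarlike_ofReal (hψ : IsMaMinda ψ) {x : ℝ} (hx : x ∈ Ioo (-1) 1)
    (hx0 : x ≠ 0) :
    extremalStarlike ψ x = ((x * Real.exp (maMindaPrimitive ψ x) : ℝ) : ℂ) := by
  have h : (∫ s in (0 : ℝ)..1, (ψ (s * x) - 1) / (s * x) * x) = (maMindaPrimitive ψ x : ℂ) := by
    have h1 : (∫ s in (0 : ℝ)..1, (ψ (s * x) - 1) / (s * x) * x) =
        ∫ s in (0 : ℝ)..1, (((dslope ψ 0 ((s * x : ℝ) : ℂ)).re * x : ℝ) : ℂ) := by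
      -- The open interval avoids s = 0, where the left integrand is 0/0 = 0 but `dslope` gives
      -- ψ'(0).
      refine intervalIntegral.integral_congr_Ioo_of_le zero_le_one fun s hs => ?_
      have hsx : s * x ∈ Ioo (-1 : ℝ) 1 := by
        rw [mem_Ioo, ← abs_lt, abs_mul, abs_of_pos hs.1]
        exact mul_lt_one_of_nonneg_of_lt_one_left hs.1.le hs.2 (abs_lt.2 hx).le
      have := hψ.dslope_ofReal hsx (mul_ne_zero hs.1.ne' hx0)
      push_cast at this ⊢
      rw [this]
    rw [h1, intervalIntegral.integral_ofReal, intervalIntegral.integral_mul_const, mul_comm,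
      intervalIntegral.mul_integral_comp_mul_right (f := fun t : ℝ => (dslope ψ 0 (t : ℂ)).re)]
    simp [maMindaPrimitive]
  rw [extremalStarlike, h]
  push_cast
  rfl

/-! ### Maximum and minimum modulus -/

/-- On a circle, the modulus of a Ma–Minda function bounds its modulus inside from above. -/
theorem norm_le_of_isMaxOn_sphere (hψ : IsMaMinda ψ) {r : ℝ} (hr0 : 0 < r) (hr1 : r < 1)
    {ζ : ℂ} (hmax : IsMaxOn (fun z => ‖ψ z‖) (sphere (0 : ℂ) r) ζ) {z : ℂ} (hz : ‖z‖ ≤ r) :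
    ‖ψ z‖ ≤ ‖ψ ζ‖ := by
  refine norm_le_of_forall_mem_frontier_norm_le (U := ball 0 r) isBounded_ball
    ((hψ.analytic.mono (closedBall_subset_ball hr1)).diffContOnCl_ball subset_rfl) ?_ ?_
  · rw [frontier_ball _ hr0.ne']
    exact fun z hz => hmax hz
  · rw [closure_ball _ hr0.ne']
    simpa using hz

/-- On a circle, the modulus of a Ma–Minda function bounds its modulus inside from below. -/
theorem norm_le_of_isMinOn_sphere (hψ : IsMaMinda ψ) {r : ℝ} (hr0 : 0 < r) (hr1 : r < 1)
    {ζ : ℂ} (hζ : ζ ∈ sphere (0 : ℂ) r)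
    (hmin : IsMinOn (fun z => ‖ψ z‖) (sphere (0 : ℂ) r) ζ) {z : ℂ} (hz : ‖z‖ ≤ r) :
    ‖ψ ζ‖ ≤ ‖ψ z‖ := by
  have hsub : closedBall (0 : ℂ) r ⊆ ball 0 1 := closedBall_subset_ball hr1
  have hne : ∀ z ∈ ball (0 : ℂ) 1, ψ z ≠ 0 := fun z hz h => by
    simpa [h] using hψ.re_pos z hz
  have hpos : ∀ z ∈ closedBall (0 : ℂ) r, 0 < ‖ψ z‖ := fun z hz =>
    norm_pos_iff.2 (hne z (hsub hz))
  have h : ‖(ψ z)⁻¹‖ ≤ ‖ψ ζ‖⁻¹ := by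
    refine norm_le_of_forall_mem_frontier_norm_le (f := fun z => (ψ z)⁻¹) (U := ball 0 r)
      isBounded_ball (((hψ.analytic.inv hne).mono hsub).diffContOnCl_ball subset_rfl) ?_ ?_
    · rw [frontier_ball _ hr0.ne']
      intro y hy
      rw [norm_inv]
      exact inv_anti₀ (hpos ζ (sphere_subset_closedBall hζ)) (hmin hy)
    · rw [closure_ball _ hr0.ne']
      simpa using hz
  rw [norm_inv] at h
  exact (inv_le_inv₀ (hpos z (by simpa using hz)) (hpos ζ (sphere_subset_closedBall hζ))).1 h

end IsMaMinda

/-! ### Growth and distortion -/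

namespace MaMindaStarlike

variable {ψ f : ℂ → ℂ}

/-- The growth theorem for `𝒮*(ψ)`, with the bounds in exponential form. -/
theorem growth (hψ : IsMaMinda ψ) (hf : MaMindaStarlike ψ f) {z : ℂ}
    (hz : z ∈ ball (0 : ℂ) 1) (hz0 : z ≠ 0) :
    Real.exp (maMindaPrimitive ψ (-‖z‖)) ≤ ‖f z / z‖ ∧
      ‖f z / z‖ ≤ Real.exp (maMindaPrimitive ψ ‖z‖) := by
  obtain ⟨w, hwd, hwm, hw0, hw⟩ := hf.subordinate
  set q := dslope f 0 with hq
  have hqne : ∀ z : ℂ, z ≠ 0 → q z = f z / z := fun z hz => by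
    rw [hq, dslope_of_ne _ hz, slope_def_field, hf.normalized.map_zero, sub_zero, sub_zero]
  have hqd : DifferentiableOn ℂ q (ball 0 1) :=
    (differentiableOn_dslope (ball_mem_nhds 0 one_pos)).2 hf.normalized.analytic
  have hq0 : q 0 = 1 := by rw [hq, dslope_same, hf.normalized.deriv_zero]
  have hq_ne : ∀ z ∈ ball (0 : ℂ) 1, q z ≠ 0 := fun z hz => by
    rcases eq_or_ne z 0 with rfl | hz0
    · simp [hq0]
    · rw [hqne z hz0]
      exact div_ne_zero (hf.ne_zero z hz hz0) hz0
  obtain ⟨p, hp0, hpd, hqp⟩ := exists_log_of_ne_zero_ball hqd hq_ne hq0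
  have hpdiff : DifferentiableOn ℂ p (ball 0 1) := fun z hz =>
    (hpd z hz).differentiableAt.differentiableWithinAt
  have hzp : ∀ z ∈ ball (0 : ℂ) 1, z ≠ 0 → z * deriv p z = ψ (w z) - 1 := by
    intro z hz hz0
    have h1 : HasDerivAt q ((deriv f z * z - f z * 1) / z ^ 2) z := by
      refine ((hf.normalized.analytic.differentiableAt
        (isOpen_ball.mem_nhds hz)).hasDerivAt.div (hasDerivAt_id' z) hz0).congr_of_eventuallyEq ?_
      filter_upwards [isOpen_ne.mem_nhds hz0] with y hy using hqne y hy
    have h2 := hw z hz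
    rw [starlikeQuotient, if_neg hz0] at h2
    rw [(hpd z hz).deriv, h1.deriv, hqne z hz0, ← h2]
    have := hf.ne_zero z hz hz0
    field_simp
  have hwle : ∀ z ∈ ball (0 : ℂ) 1, ‖w z‖ ≤ ‖z‖ := fun z hz =>
    norm_le_norm_of_mapsTo_ball hwd (hwm.mono_right ball_subset_closedBall) hw0 (by simpa using hz)
  have hreal : ∀ z ∈ ball (0 : ℂ) 1, (ψ (w z)).im = 0 →
      (ψ ((-‖z‖ : ℝ) : ℂ)).re ≤ (ψ (w z)).re ∧ (ψ (w z)).re ≤ (ψ (‖z‖ : ℝ)).re := by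
    intro z hz him
    have hwim := hψ.im_eq_zero_of_im_map_eq_zero (hwm hz) him
    have hwre : w z = ((w z).re : ℂ) := Complex.ext (by simp) (by simpa using hwim)
    have hle : |(w z).re| ≤ ‖z‖ := (abs_re_le_norm _).trans (hwle z hz)
    have hz1 : ‖z‖ < 1 := by simpa using hz
    obtain ⟨h1, h2⟩ := abs_le.1 hle
    have hz2 := norm_nonneg z
    rw [hwre]
    exact ⟨hψ.strictMonoOn_re.monotoneOn ⟨by linarith, by linarith⟩
        ⟨by linarith, by linarith⟩ h1,
      hψ.strictMonoOn_re.monotoneOn ⟨by linarith, by linarith⟩ ⟨by linarith, by linarith⟩ h2⟩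
  have hP0 : maMindaPrimitive ψ 0 = 0 := intervalIntegral.integral_same
  have hupper : (p z).re ≤ maMindaPrimitive ψ ‖z‖ := by
    refine re_le_of_im_mul_deriv_eq_zero (g := fun t => (ψ (t : ℂ)).re - 1) hpdiff hp0 hP0
      hψ.continuousOn_maMindaPrimitive (fun t ht => ?_) (fun z hz hz0 him => ?_) hz
    · exact hψ.hasDerivAt_maMindaPrimitive_of_ne_zero ⟨by linarith [ht.1], ht.2⟩ ht.1.ne'
    · rw [hzp z hz hz0] at him ⊢
      simp only [sub_im, one_im, sub_zero] at him
      simpa using (hreal z hz him).2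
  -- The same principle for -p, with H(t) = -P(-t), whose derivative is (1 - ψ(-t))/t.
  have hlower : ((-p) z).re ≤ -maMindaPrimitive ψ (-‖z‖) := by
    refine re_le_of_im_mul_deriv_eq_zero (p := -p) (H := fun t => -maMindaPrimitive ψ (-t))
      (g := fun t => -((ψ ((-t : ℝ) : ℂ)).re - 1)) hpdiff.neg (by simp [hp0]) (by simp [hP0])
      ((hψ.continuousOn_maMindaPrimitive.comp continuous_neg.continuousOn
        fun t ht => ⟨by linarith [ht.2], by linarith [ht.1]⟩).neg)
      (fun t ht => ?_) (fun z hz hz0 him => ?_) hz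
    · have h1 := hψ.hasDerivAt_maMindaPrimitive_of_ne_zero (x := -t)
        ⟨by linarith [ht.2], by linarith [ht.1]⟩ (neg_ne_zero.2 ht.1.ne')
      convert! (h1.comp t (hasDerivAt_neg t)).neg using 1
      rw [mul_neg_one, neg_neg, div_neg, neg_div]
    · rw [deriv.neg, mul_neg, hzp z hz hz0] at him ⊢
      simp only [neg_im, sub_im, one_im, sub_zero, neg_eq_zero] at him
      rw [neg_re, neg_le_neg_iff, sub_re, one_re]
      exact sub_le_sub_right (hreal z hz him).1 1
  rw [← hqne z hz0, hqp z hz, norm_exp, Real.exp_le_exp, Real.exp_le_exp]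
  rw [Pi.neg_apply, neg_re] at hlower
  exact ⟨by linarith, hupper⟩

end MaMindaStarlike

theorem mainTheorem2 (ψ : ℂ → ℂ) (hψ : IsMaMinda ψ) (r : ℝ) (hr0 : 0 < r) (hr1 : r < 1)
    (z₁ z₂ : ℂ) (hz₁ : z₁ ∈ Metric.sphere (0 : ℂ) r) (hz₂ : z₂ ∈ Metric.sphere (0 : ℂ) r)
    (hmin : IsMinOn (fun z => ‖ψ z‖) (Metric.sphere (0 : ℂ) r) z₁)
    (hmax : IsMaxOn (fun z => ‖ψ z‖) (Metric.sphere (0 : ℂ) r) z₂) :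
    -- `f₀(r)` and `f₀(-r)` are real numbers
    (extremalStarlike ψ (r : ℂ)).im = 0 ∧ (extremalStarlike ψ (-r : ℂ)).im = 0 ∧
    ∀ f : ℂ → ℂ, MaMindaStarlike ψ f → ∀ z₀ : ℂ, ‖z₀‖ = r →
      ‖ψ z₁‖ * (-(extremalStarlike ψ (-r : ℂ)).re / r) ≤ ‖deriv f z₀‖ ∧
      ‖deriv f z₀‖ ≤ (extremalStarlike ψ (r : ℂ)).re / r * ‖ψ z₂‖ := by
  have hpos := hψ.extremalStarlike_ofReal (x := r) ⟨by linarith, hr1⟩ hr0.ne'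
  have hneg := hψ.extremalStarlike_ofReal (x := -r) ⟨by linarith, by linarith⟩
    (neg_ne_zero.2 hr0.ne')
  rw [ofReal_neg] at hneg
  rw [hpos, hneg]
  refine ⟨ofReal_im _, ofReal_im _, fun f hf z₀ hz₀ => ?_⟩
  have hzb : z₀ ∈ ball (0 : ℂ) 1 := by simpa [hz₀] using hr1
  have hz0 : z₀ ≠ 0 := norm_pos_iff.1 (hz₀ ▸ hr0)
  obtain ⟨hlow, hup⟩ := hf.growth hψ hzb hz0
  obtain ⟨w, hwd, hwm, hw0, hw⟩ := hf.subordinate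
  have hwr : ‖w z₀‖ ≤ r := hz₀ ▸ norm_le_norm_of_mapsTo_ball hwd
    (hwm.mono_right ball_subset_closedBall) hw0 (by simpa using hzb)
  have hder : deriv f z₀ = f z₀ / z₀ * ψ (w z₀) := by
    have h := hw z₀ hzb
    rw [starlikeQuotient, if_neg hz0] at h
    have := hf.ne_zero z₀ hzb hz0
    rw [← h]
    field_simp
  rw [hz₀] at hlow hup
  rw [ofReal_re, ofReal_re, hder, norm_mul, neg_mul, neg_neg, mul_div_cancel_left₀ _ hr0.ne',
    mul_div_cancel_left₀ _ hr0.ne', mul_comm ‖ψ z₁‖]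
  exact ⟨mul_le_mul hlow (hψ.norm_le_of_isMinOn_sphere hr0 hr1 hz₁ hmin hwr) (norm_nonneg _)
      (norm_nonneg _),
    mul_le_mul hup (hψ.norm_le_of_isMaxOn_sphere hr0 hr1 hmax hwr) (norm_nonneg _)
      (Real.exp_pos _).le⟩
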